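/- For $c>0$ let $X_n$ be the adjacency matrix of the Erdős–Rényi random graph $G(n,c/n)$ and let $$\mu_n^c=\frac1n\sum_{\lambda\in \mathrm{Sp}(c^{-1/2}X_n)}\delta_\lambda$$ be its normalised spectral measure (eigenvalues counted with multiplicity). Let $\mu^c$ be the limiting spectral measure, i.e. the unique probability measure on $\mathbb R$ such that $\mathbb E\int f\,d\mu_n^c\to\int f\,d\mu^c$ as $n\to\infty$ for every bounded continuous $f:\mathbb R\to\mathbb R$; for every $c>0$ it exists. Let $\sigma$ be the semicircle law, with density $\frac{1}{2\pi}\sqrt{4-x^2}\,\mathbf 1_{|x|<2}$, and let $\sigma^{\{1\}}$ be the signed measure with (integrable) density $$\frac1{2\pi}\,\frac{x^4-4x^2+2}{\sqrt{4-x^2}}\,\mathbf 1_{|x|<2},$$ which has total mass $0$. For a (signed) measure $\nu$ on $\mathbb R$ and an integer $k\ge 0$ write $m_k(\nu)=\int x^k\,d\nu(x)$ for its moment of order $k$, which exists when $\int|x|^k\,d|\nu|(x)<\infty$. Then for every integer $k\ge0$ the moments $m_k(\mu^c)$ and $m_k\left(\sigma+\frac1c\sigma^{\{1\}}\right)$ exist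 for all $c>0$, and, as $c\to\infty$, $$m_k(\mu^c)=m_k\left(\sigma+\frac1c\,\sigma^{\{1\}}\right)+o\left(\frac1c\right).$$ -/

import Mathlib

open MeasureTheory Filter Topology Asymptotics

/-- The edge probability `c / n`, as a point of `[0, 1]`; values above `1` are truncated to `1`,
which affects only the finitely many `n < c`. -/
noncomputable def edgeProb (c : ℝ) (n : ℕ) : unitInterval :=
  Set.projIcc (0 : ℝ) 1 zero_le_one (c / n)

open Classical in
/-- The rescaled adjacency matrix `c ^ (-1/2) • X` of a graph on `n` vertices. -/
noncomputable def rescaledAdj (c : ℝ) {n : ℕ} (G : SimpleGraph (Fin n)) :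
    Matrix (Fin n) (Fin n) ℝ :=
  (Real.sqrt c)⁻¹ • G.adjMatrix ℝ

theorem rescaledAdj_isHermitian (c : ℝ) {n : ℕ} (G : SimpleGraph (Fin n)) :
    (rescaledAdj c G).IsHermitian := by
  classical
  ext i j
  simp [rescaledAdj, SimpleGraph.adjMatrix_apply, G.adj_comm]

/-- The normalised spectral measure `(1 / n) ∑ δ_λ`, the sum running over the eigenvalues of the
rescaled adjacency matrix, counted with multiplicity. -/
noncomputable def spectralMeasure (c : ℝ) {n : ℕ} (G : SimpleGraph (Fin n)) : Measure ℝ :=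
  (n : ENNReal)⁻¹ •
    ∑ i : Fin n, Measure.dirac ((rescaledAdj_isHermitian c G).eigenvalues i)

/-- `μ` is the weak limit, as `n → ∞`, of the (averaged) normalised spectral measures of the
random graphs `G(n, c / n)`: for every bounded continuous `f`, the expectation of the integral of
`f` against the random spectral measure converges to the integral of `f` against `μ`. -/
def IsLimitingSpectralMeasure (c : ℝ) (μ : Measure ℝ) : Prop :=
  ∀ f : BoundedContinuousFunction ℝ ℝ,
    Tendsto
      (fun n : ℕ => ∫ G : SimpleGraph (Fin n), (∫ x, f x ∂(spectralMeasure c G))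
        ∂(SimpleGraph.binomialRandom (Fin n) (edgeProb c n)))
      atTop (𝓝 (∫ x, f x ∂μ))

/-- The density of the semicircle law. -/
noncomputable def semicircleDensity : ℝ → ℝ :=
  (Set.Ioo (-2 : ℝ) 2).indicator fun x => 1 / (2 * Real.pi) * Real.sqrt (4 - x ^ 2)

/-- The density of the first order correction. -/
noncomputable def correctionDensity : ℝ → ℝ :=
  (Set.Ioo (-2 : ℝ) 2).indicator fun x =>
    1 / (2 * Real.pi) * ((x ^ 4 - 4 * x ^ 2 + 2) / Real.sqrt (4 - x ^ 2))

/-- The semicircle law `σ`, as a signed measure. -/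
noncomputable def semicircleLaw : SignedMeasure ℝ :=
  (volume : Measure ℝ).withDensityᵥ semicircleDensity

/-- The first order correction `σ^{1}`, a signed measure. -/
noncomputable def semicircleCorrection : SignedMeasure ℝ :=
  (volume : Measure ℝ).withDensityᵥ correctionDensity

/-- The moment of order `k` of a signed measure exists: `|x| ^ k` is integrable for its total
variation. -/
def HasMoment (k : ℕ) (s : SignedMeasure ℝ) : Prop :=
  Integrable (fun x : ℝ => |x| ^ k) s.totalVariation

/-- The moment of order `k` of a signed measure. -/
noncomputable def signedMoment (k : ℕ) (s : SignedMeasure ℝ) : ℝ :=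
  ∫ᵛ x, x ^ k ∂<•s

/-! By the trace formula, the `k`-th moment of the mean spectral measure is `c ^ (-k/2)` times the
expected number of closed walks of length `k` at a vertex of `G(n, c/n)`. Reveal the graph along the
walk: when `m` vertices are known, a step to an unseen vertex has total weight `(n - m) * p`, which
tends to `c`, while a step along a new edge between known vertices has weight `p`, which tends to
`0` (`integral_indicator_adjMatrix_pow`, `tendsto_explorationSum`). In the limit only walks on
growing trees survive, each new edge weighing `c`.

Rescale by one factor `√c` per level of the tree. Then a step to a new child and a step back to the
parent each cost `√c`, and re-entering an old child costs a further `1/c`. The limiting moment is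
therefore a polynomial in `1/c`. Its constant coefficient counts walks with no re-entry: these are
Dyck paths, and the reflection principle gives `P k 0 - P k 2`, where `P k j` counts the `k`-step
`±1` walks ending at `j`. Its linear coefficient allows one re-entry. It depends on the current tree
only through the number `h` of vertices on the path to the root and the total number `s` of their
children, and it has a closed form stable under the recursion; at the start, `h = 1` and `s = 0`, it
equals `P k 4` (`IsRecursiveTree.exists_polynomial`). Since `P k j` is also the Fourier coefficient
of `(2 cos θ) ^ k`, the substitution `x = 2 cos θ` identifies the two coefficients with the moments
of `σ` and of its correction.

For the existence of the limit law, the exploration sums are dominated by Poisson moments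
(`explorationSum_nonneg_and_le`). These grow slowly enough for the power series of the
characteristic functions to converge dominatedly at every `t`, and Lévy's continuity theorem
applies. The same bounds, at order `2k`, carry the `k`-th moments through any weak limit. -/

/-! ### Exploration of closed walks -/

/-- Weighted number of closed walks completing a partially explored graph. The vertices
`0, …, m - 1` and the edges in `E` have been revealed, the walk is at `u`, has `k` steps left and
must end at `0`. A step to a new vertex has weight `a m`, a step along a revealed edge has
weight `1`, and a step along a new edge between revealed vertices has weight `p`. -/
noncomputable def explorationSum (a : ℕ → ℝ) (p : ℝ) : ℕ → ℕ → Finset (Sym2 ℕ) → ℕ → ℝ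
  | 0, _, _, u => if u = 0 then 1 else 0
  | k + 1, m, E, u => a m * explorationSum a p k (m + 1) (insert s(u, m) E) m +
      ∑ v ∈ (Finset.range m).erase u,
        (if s(u, v) ∈ E then 1 else p) * explorationSum a p k m (insert s(u, v) E) v

theorem tendsto_explorationSum {ι : Type*} {l : Filter ι} {a : ι → ℕ → ℝ} {p : ι → ℝ} {c q : ℝ}
    (ha : ∀ m, Tendsto (fun i => a i m) l (𝓝 c)) (hp : Tendsto p l (𝓝 q)) (k : ℕ) :
    ∀ (m : ℕ) (E : Finset (Sym2 ℕ)) (u : ℕ),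
      Tendsto (fun i => explorationSum (a i) (p i) k m E u) l
        (𝓝 (explorationSum (fun _ => c) q k m E u)) := by
  induction k with
  | zero => intro m E u; simp only [explorationSum]; exact tendsto_const_nhds
  | succ k ih =>
    intro m E u
    simp only [explorationSum]
    refine ((ha m).mul (ih _ _ _)).add (tendsto_finsetSum _ fun v _ => Tendsto.mul ?_ (ih _ _ _))
    split_ifs
    · exact tendsto_const_nhds
    · exact hp

/-! ### Domination by Poisson moments -/

/-- Up to normalisation, the `k`-th moment of `m + N` with `N` a Poisson variable. -/
noncomputable def poissonMoment (c : ℝ) (k m : ℕ) : ℝ :=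
  ∑' j : ℕ, c ^ j / j.factorial * ((m : ℝ) + j) ^ k

theorem add_pow_le_factorial_mul_exp {r : ℝ} (hr : 0 < r) {x : ℝ} (hx : 0 ≤ x) (k : ℕ) :
    x ^ k ≤ k.factorial * r⁻¹ ^ k * Real.exp (r * x) := by
  have h := Real.pow_div_factorial_le_exp (x := r * x) (by positivity) k
  rw [div_le_iff₀ (by positivity), mul_pow] at h
  calc x ^ k = r⁻¹ ^ k * (r ^ k * x ^ k) := by
        rw [← mul_assoc, ← mul_pow, inv_mul_cancel₀ hr.ne', one_pow, one_mul]
    _ ≤ r⁻¹ ^ k * (Real.exp (r * x) * k.factorial) := by gcongr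
    _ = _ := by ring

theorem hasSum_poisson_exp (c r : ℝ) (m : ℕ) (C : ℝ) :
    HasSum (fun j : ℕ => c ^ j / j.factorial * (C * Real.exp (r * (m + j))))
      (C * Real.exp (r * m) * Real.exp (c * Real.exp r)) := by
  have h := (NormedSpace.expSeries_div_hasSum_exp (𝔸 := ℝ) (c * Real.exp r)).mul_left
    (C * Real.exp (r * m))
  rw [← Real.exp_eq_exp_ℝ] at h
  refine h.congr_fun fun j => ?_
  rw [mul_add, Real.exp_add, mul_pow, ← Real.exp_nat_mul, mul_comm r (j : ℝ)]
  ring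

theorem poissonMoment_term_le {c r : ℝ} (hc : 0 ≤ c) (hr : 0 < r) (k m j : ℕ) :
    c ^ j / j.factorial * ((m : ℝ) + j) ^ k ≤
      c ^ j / j.factorial * ((k.factorial * r⁻¹ ^ k) * Real.exp (r * (m + j))) := by
  have := add_pow_le_factorial_mul_exp hr (x := (m : ℝ) + j) (by positivity) k
  gcongr

theorem summable_poissonMoment {c : ℝ} (hc : 0 ≤ c) (k m : ℕ) :
    Summable fun j : ℕ => c ^ j / j.factorial * ((m : ℝ) + j) ^ k :=
  .of_nonneg_of_le (fun j => by positivity) (poissonMoment_term_le hc one_pos k m)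
    (hasSum_poisson_exp c 1 m _).summable

theorem poissonMoment_nonneg {c : ℝ} (hc : 0 ≤ c) (k m : ℕ) : 0 ≤ poissonMoment c k m :=
  tsum_nonneg fun j => by positivity

theorem one_le_poissonMoment_zero {c : ℝ} (hc : 0 ≤ c) (m : ℕ) : 1 ≤ poissonMoment c 0 m := by
  have := (summable_poissonMoment hc 0 m).le_tsum 0 (fun j _ => by positivity)
  simpa [poissonMoment] using this

theorem poissonMoment_le {c r : ℝ} (hc : 0 ≤ c) (hr : 0 < r) (k m : ℕ) :
    poissonMoment c k m ≤
      (k.factorial * r⁻¹ ^ k) * Real.exp (r * m) * Real.exp (c * Real.exp r) :=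
  ((summable_poissonMoment hc k m).tsum_le_tsum (poissonMoment_term_le hc hr k m)
    (hasSum_poisson_exp c r m _).summable).trans_eq (hasSum_poisson_exp c r m _).tsum_eq

/-- Split one factor `m + j`: the part `j` cancels against `j!` and shifts the index. This is the
exploration recursion with every weight replaced by its upper bound. -/
theorem poissonMoment_succ {c : ℝ} (hc : 0 ≤ c) (k m : ℕ) :
    poissonMoment c (k + 1) m = c * poissonMoment c k (m + 1) + m * poissonMoment c k m := by
  have h1 : Summable fun j : ℕ => c ^ j / j.factorial * (j * ((m : ℝ) + j) ^ k) := by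
    refine .of_nonneg_of_le (fun j => by positivity) (fun j => ?_)
      (summable_poissonMoment hc (k + 1) m)
    rw [pow_succ']
    have : (j : ℝ) ≤ m + j := by simp
    gcongr
  rw [poissonMoment, poissonMoment, poissonMoment, ← tsum_mul_left, ← tsum_mul_left]
  have h2 : ∑' j : ℕ, c * (c ^ j / j.factorial * (((m + 1 : ℕ) : ℝ) + j) ^ k) =
      ∑' j : ℕ, c ^ j / j.factorial * (j * ((m : ℝ) + j) ^ k) := by
    rw [h1.tsum_eq_zero_add]
    simp only [CharP.cast_eq_zero, zero_mul, mul_zero, zero_add]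
    refine tsum_congr fun j => ?_
    rw [Nat.factorial_succ]
    push_cast
    have : (j.factorial : ℝ) ≠ 0 := by positivity
    have : (j + 1 : ℝ) ≠ 0 := by positivity
    field_simp
    rw [show (m : ℝ) + 1 + j = m + (j + 1) by ring]
    ring
  rw [h2, ← h1.tsum_add ((summable_poissonMoment hc k m).mul_left _)]
  exact tsum_congr fun j => by ring

/-- Compare the two recursions term by term: the weight of a new vertex is at most `c`, and at most
`m` revealed vertices are reachable, each with weight at most `1`. -/
theorem explorationSum_nonneg_and_le {n : ℕ} {p c : ℝ} (hp0 : 0 ≤ p) (hp1 : p ≤ 1) (hc : 0 ≤ c)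
    (hpc : n * p ≤ c) (k : ℕ) : ∀ (m : ℕ) (E : Finset (Sym2 ℕ)) (u : ℕ), m ≤ n → u < m →
      0 ≤ explorationSum (fun m => (n - m) * p) p k m E u ∧
      explorationSum (fun m => (n - m) * p) p k m E u ≤ poissonMoment c k m := by
  induction k with
  | zero =>
    intro m E u _ _
    have := one_le_poissonMoment_zero hc m
    simp only [explorationSum]
    split_ifs <;> constructor <;> linarith
  | succ k ih =>
    intro m E u hm hu
    have hnm : (0 : ℝ) ≤ n - m := by simpa using hm
    have hnew : 0 ≤ (n - m) * p * explorationSum (fun m => (n - m) * p) p k (m + 1)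
          (insert s(u, m) E) m ∧ (n - m) * p * explorationSum (fun m => (n - m) * p) p k (m + 1)
          (insert s(u, m) E) m ≤ c * poissonMoment c k (m + 1) := by
      -- If `m = n`, no vertex is left to discover; the induction hypothesis is then unavailable,
      -- but the weight `n - m` vanishes.
      rcases hm.lt_or_eq with hlt | rfl
      · obtain ⟨h0, h1⟩ := ih (m + 1) (insert s(u, m) E) m hlt m.lt_succ_self
        refine ⟨by positivity, mul_le_mul ?_ h1 h0 hc⟩
        nlinarith [(Nat.cast_nonneg m : (0 : ℝ) ≤ m)]
      · have := poissonMoment_nonneg hc k (m + 1)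
        simp only [sub_self, zero_mul, le_refl, true_and]
        positivity
    have hold : ∀ v ∈ (Finset.range m).erase u,
        0 ≤ (if s(u, v) ∈ E then 1 else p) * explorationSum (fun m => (n - m) * p) p k m
          (insert s(u, v) E) v ∧ (if s(u, v) ∈ E then 1 else p) *
          explorationSum (fun m => (n - m) * p) p k m (insert s(u, v) E) v ≤
          poissonMoment c k m := by
      intro v hv
      obtain ⟨h0, h1⟩ := ih m (insert s(u, v) E) v hm (by simpa using (Finset.mem_erase.1 hv).2)
      split_ifs
      · simpa using ⟨h0, h1⟩
      · exact ⟨by positivity, (mul_le_of_le_one_left h0 hp1).trans h1⟩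
    rw [poissonMoment_succ hc]
    simp only [explorationSum]
    refine ⟨add_nonneg hnew.1 (Finset.sum_nonneg fun v hv => (hold v hv).1),
      add_le_add hnew.2 ((Finset.sum_le_card_nsmul _ _ _ fun v hv => (hold v hv).2).trans ?_)⟩
    rw [nsmul_eq_mul]
    refine mul_le_mul_of_nonneg_right ?_ (poissonMoment_nonneg hc k m)
    exact_mod_cast (Finset.card_erase_le).trans (Finset.card_range m).le

/-! ### Walks on recursive trees and the expansion in `1 / c` -/

/-- The sum of `f` over the ancestors of `u`, including `u`, in the tree given by the parent
function `par`. -/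
def ancestorSum (par : ℕ → ℕ) (f : ℕ → ℕ) (u : ℕ) : ℕ :=
  if par u < u then ancestorSum par f (par u) + f u else f u
termination_by u

theorem ancestorSum_of_lt {par f : ℕ → ℕ} {u : ℕ} (h : par u < u) :
    ancestorSum par f u = ancestorSum par f (par u) + f u := by
  rw [ancestorSum, if_pos h]

theorem ancestorSum_zero (par f : ℕ → ℕ) : ancestorSum par f 0 = f 0 := by
  rw [ancestorSum, if_neg (by simp)]

theorem ancestorSum_congr {par par' f f' : ℕ → ℕ} (u : ℕ) (hp : ∀ i ≤ u, par' i = par i)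
    (hf : ∀ i ≤ u, f' i = f i) : ancestorSum par' f' u = ancestorSum par f u := by
  induction u using Nat.strong_induction_on with
  | _ u ih =>
    rw [ancestorSum.eq_1 par', ancestorSum.eq_1 par, hp u le_rfl, hf u le_rfl]
    split_ifs with h
    · rw [ih _ h (fun i hi => hp i (hi.trans h.le)) (fun i hi => hf i (hi.trans h.le))]
    · rfl

/-- The children of `u` among the vertices `0, …, m - 1`. -/
def treeChildren (par : ℕ → ℕ) (m u : ℕ) : Finset ℕ :=
  (Finset.range m).filter fun v => 0 < v ∧ par v = u

/-- `E` is the set of edges of the tree on `0, …, m - 1` with parent function `par`. -/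
structure IsRecursiveTree (m : ℕ) (E : Finset (Sym2 ℕ)) (par : ℕ → ℕ) : Prop where
  par_lt : ∀ v, 0 < v → par v < v
  mem_iff : ∀ u v, s(u, v) ∈ E ↔ (0 < v ∧ v < m ∧ par v = u) ∨ (0 < u ∧ u < m ∧ par u = v)

theorem IsRecursiveTree.insert_leaf {m : ℕ} {E : Finset (Sym2 ℕ)} {par : ℕ → ℕ}
    (h : IsRecursiveTree m E par) {u : ℕ} (hu : u < m) :
    IsRecursiveTree (m + 1) (insert s(u, m) E) (Function.update par m u) where
  par_lt v hv := by
    rcases eq_or_ne v m with rfl | hvm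
    · simpa using hu
    · simpa [hvm] using h.par_lt v hv
  mem_iff x y := by
    have h1 := h.par_lt x
    have h2 := h.par_lt y
    rw [Finset.mem_insert, h.mem_iff, Sym2.eq_iff]
    simp only [Function.update_apply]
    split_ifs <;> omega

theorem treeChildren_update {m u v : ℕ} {par : ℕ → ℕ} (hu : u < m) :
    (treeChildren (Function.update par m u) (m + 1) v).card =
      (treeChildren par m v).card + if v = u then 1 else 0 := by
  have h : ((Finset.range m).filter fun w => 0 < w ∧ Function.update par m u w = v) =
      (Finset.range m).filter fun w => 0 < w ∧ par w = v := by
    refine Finset.filter_congr fun w hw => ?_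
    rw [Function.update_of_ne (Finset.mem_range.1 hw).ne]
  rw [treeChildren, treeChildren, Finset.range_add_one, Finset.filter_insert, h]
  rcases eq_or_ne v u with rfl | hv
  · rw [if_pos ⟨by omega, by simp⟩, if_pos rfl, Finset.card_insert_of_notMem (by simp)]
  · rw [if_neg (by simp [hv.symm]), if_neg hv, add_zero]

/-- With cycle-closing steps suppressed, only tree neighbours contribute: the parent, if there is
one, and the children. Their edges already lie in `E`, so `E` does not change. -/
theorem IsRecursiveTree.sum_neighbors {m : ℕ} {E : Finset (Sym2 ℕ)} {par : ℕ → ℕ}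
    (h : IsRecursiveTree m E par) {u : ℕ} (hu : u < m) (f : Finset (Sym2 ℕ) → ℕ → ℝ) :
    ∑ v ∈ (Finset.range m).erase u, (if s(u, v) ∈ E then 1 else 0) * f (insert s(u, v) E) v =
      (if 0 < u then f E (par u) else 0) + ∑ v ∈ treeChildren par m u, f E v := by
  have hfil : ((Finset.range m).erase u).filter (fun v => s(u, v) ∈ E) =
      (if 0 < u then {par u} else ∅) ∪ treeChildren par m u := by
    ext v
    have h1 := h.par_lt u
    have h2 := h.par_lt v
    simp only [Finset.mem_filter, Finset.mem_erase, Finset.mem_range, h.mem_iff, treeChildren,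
      Finset.mem_union]
    split_ifs <;> (simp; omega)
  have hdisj : Disjoint (if 0 < u then {par u} else ∅) (treeChildren par m u) := by
    rw [Finset.disjoint_left]
    intro v
    have h1 := h.par_lt u
    have h2 := h.par_lt v
    simp only [treeChildren, Finset.mem_filter]
    split_ifs <;> simp
    omega
  calc _ = ∑ v ∈ ((Finset.range m).erase u).filter (fun v => s(u, v) ∈ E), f E v := by
        rw [Finset.sum_filter]
        refine Finset.sum_congr rfl fun v _ => ?_
        split_ifs with hv
        · rw [one_mul, Finset.insert_eq_of_mem hv]
        · rw [zero_mul]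
    _ = _ := by
        rw [hfil, Finset.sum_union hdisj]
        split_ifs <;> simp

open Polynomial in
/-- On a recursive tree, the exploration sum with no cycle-closing steps is, up to normalisation,
a polynomial in `1 / c`, whose first two coefficients are expressed through any symmetric solution
`P` of the simple random walk recursion. -/
theorem IsRecursiveTree.exists_polynomial (P : ℕ → ℤ → ℝ) (P_zero : P 0 0 = 1)
    (P_zero_ne : ∀ j, 0 < j → P 0 j = 0) (P_succ : ∀ k j, P (k + 1) j = P k (j + 1) + P k (j - 1))
    (P_neg : ∀ k j, P k (-j) = P k j) (k : ℕ) :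
    ∀ (m : ℕ) (E : Finset (Sym2 ℕ)) (par : ℕ → ℕ) (u : ℕ), IsRecursiveTree m E par → u < m →
      ∀ h s : ℕ, h = ancestorSum par (fun _ => 1) u →
        s = ancestorSum par (fun v => (treeChildren par m v).card) u →
      ∃ Q : ℝ[X], Q.coeff 0 = P k (h - 1) - P k (h + 1) ∧
        Q.coeff 1 = h * P k (h + 3) + s * (P k (h + 1) - P k (h + 3)) ∧
        ∀ c : ℝ, 0 < c → Real.sqrt c ^ h * explorationSum (fun _ => c) 0 k m E u =
          Real.sqrt c ^ (k + 1) * Q.eval (1 / c) := by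
  induction k with
  | zero =>
    intro m E par u hT hu h s hh hs
    rcases Nat.eq_zero_or_pos u with rfl | hu0
    · rw [ancestorSum_zero] at hh
      subst hh
      refine ⟨1, ?_, ?_, ?_⟩
      · rw [P_zero_ne ((1 : ℕ) + 1) (by norm_num)]; simp [P_zero]
      · rw [P_zero_ne _ (by norm_num), P_zero_ne _ (by norm_num)]
        simp [Polynomial.coeff_one]
      · simp [explorationSum]
    · rw [ancestorSum_of_lt (hT.par_lt u hu0)] at hh
      -- Away from the root the path to the root has at least two vertices, so every index of `P 0`
      -- below is positive and both sides vanish.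
      have h2 : 2 ≤ h := by
        rw [ancestorSum] at hh
        split_ifs at hh <;> omega
      refine ⟨0, ?_, ?_, ?_⟩
      · rw [P_zero_ne _ (by omega), P_zero_ne _ (by omega)]; simp
      · rw [P_zero_ne _ (by omega), P_zero_ne _ (by omega)]; simp
      · simp [explorationSum, hu0.ne']
  | succ k ih =>
    intro m E par u hT hu h s hh hs
    set a := (treeChildren par m u).card with ha
    -- Step to a new leaf: the root path gains the vertex `m`, and `s` grows by one because `u`
    -- gains a child while the leaf has none.
    obtain ⟨Qn, Qn0, Qn1, Qn_eval⟩ := ih (m + 1) (insert s(u, m) E) (Function.update par m u) m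
      (hT.insert_leaf hu) m.lt_succ_self (h + 1) (s + 1) (by
        rw [ancestorSum_of_lt (by simpa using hu), Function.update_self, hh]
        congr 1
        exact (ancestorSum_congr u (fun i hi => Function.update_of_ne (by omega) _ _)
          (fun _ _ => rfl)).symm) (by
        have hm : (treeChildren par m m).card = 0 := by
          rw [Finset.card_eq_zero, treeChildren, Finset.filter_eq_empty_iff]
          intro v hv
          have := hT.par_lt v
          simp at hv
          omega
        rw [ancestorSum_of_lt (by simpa using hu), Function.update_self, treeChildren_update hu,
          hm, if_neg hu.ne', add_zero, add_zero, hs]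
        rw [ancestorSum.eq_1 (Function.update par m u), ancestorSum.eq_1 par,
          Function.update_of_ne hu.ne, treeChildren_update hu, if_pos rfl]
        have hcongr : par u < u → ancestorSum (Function.update par m u) (fun v =>
            (treeChildren (Function.update par m u) (m + 1) v).card) (par u) =
            ancestorSum par (fun v => (treeChildren par m v).card) (par u) := fun hlt =>
          ancestorSum_congr _ (fun i hi => Function.update_of_ne (by omega) _ _) fun i hi => by
            rw [treeChildren_update hu, if_neg (by omega), add_zero]
        split_ifs with hlt
        · rw [hcongr hlt]; ring
        · ring)
    -- Re-entering a child brings a factor `1 / c`, so only the constant coefficient is needed here.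
    have hch : ∀ v ∈ treeChildren par m u, ∃ Q : ℝ[X], Q.coeff 0 = P k h - P k (h + 2) ∧
        ∀ c : ℝ, 0 < c → Real.sqrt c ^ (h + 1) * explorationSum (fun _ => c) 0 k m E v =
          Real.sqrt c ^ (k + 1) * Q.eval (1 / c) := by
      intro v hv
      simp only [treeChildren, Finset.mem_filter, Finset.mem_range] at hv
      obtain ⟨hvm, hv0, hvu⟩ := hv
      obtain ⟨Q, Q0, -, Qe⟩ := ih m E par v hT hvm (h + 1) _ (by
        rw [ancestorSum_of_lt (hT.par_lt v hv0), hvu, hh]) rfl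
      refine ⟨Q, ?_, Qe⟩
      rw [Q0]
      push_cast
      congr 2; ring
    choose! Qc Qc0 Qce using hch
    have hpar : ∃ Q : ℝ[X], Q.coeff 0 = P k (h - 2) - P k h ∧
        Q.coeff 1 = (h - 1) * P k (h + 2) + (s - a) * (P k h - P k (h + 2)) ∧
        ∀ c : ℝ, 0 < c → Real.sqrt c ^ h * (if 0 < u then
          explorationSum (fun _ => c) 0 k m E (par u) else 0) =
          Real.sqrt c ^ (k + 2) * Q.eval (1 / c) := by
      -- At the root there is no parent, and the zero polynomial fits the formulas: `P k (-1) = P k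
      -- 1` by symmetry, and `h - 1 = s - a = 0`.
      rcases Nat.eq_zero_or_pos u with rfl | hu0
      · rw [ancestorSum_zero] at hh hs
        refine ⟨0, ?_, ?_, ?_⟩
        · have := P_neg k 1
          subst hh
          norm_num
          rw [this, sub_self]
        · subst hh
          rw [hs]
          simp [ha]
        · simp
      · rw [ancestorSum_of_lt (hT.par_lt u hu0)] at hh hs
        obtain ⟨Q, Q0, Q1, Qe⟩ := ih m E par (par u) hT ((hT.par_lt u hu0).trans hu) _ _ rfl rfl
        rw [← ha] at hs
        set h' := ancestorSum par (fun _ => 1) (par u)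
        set s' := ancestorSum par (fun v => (treeChildren par m v).card) (par u)
        refine ⟨Q, ?_, ?_, ?_⟩
        · rw [Q0, hh]
          push_cast
          congr 2; ring
        · rw [Q1, hh, hs]
          push_cast
          rw [show (h' : ℤ) + 1 + 2 = h' + 3 by ring]
          ring
        · intro c hc
          rw [if_pos hu0, hh, pow_succ, mul_right_comm, Qe c hc]
          ring
    obtain ⟨Qp, Qp0, Qp1, Qp_eval⟩ := hpar
    refine ⟨Qn + Qp + X * ∑ v ∈ treeChildren par m u, Qc v, ?_, ?_, ?_⟩
    · simp only [coeff_add, mul_coeff_zero, coeff_X_zero, zero_mul, add_zero, Qn0, Qp0, P_succ]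
      push_cast
      rw [show (h : ℤ) + 1 - 1 = h by ring, show (h : ℤ) - 1 + 1 = h by ring,
        show (h : ℤ) - 1 - 1 = h - 2 by ring]
      ring
    -- The `a` children contribute `a * (P k h - P k (h + 2))`, exactly what the parent term loses
    -- by having `s - a` in place of `s`.
    · rw [coeff_add, coeff_add, show (1 : ℕ) = 0 + 1 from rfl, coeff_X_mul, zero_add, Qn1, Qp1,
        finsetSum_coeff, Finset.sum_congr rfl Qc0, Finset.sum_const, ← ha, nsmul_eq_mul]
      simp only [P_succ]
      push_cast
      rw [show (h : ℤ) + 1 + 3 = h + 4 by ring, show (h : ℤ) + 1 + 1 = h + 2 by ring,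
        show (h : ℤ) + 3 + 1 = h + 4 by ring, show (h : ℤ) + 3 - 1 = h + 2 by ring,
        show (h : ℤ) + 1 - 1 = h by ring]
      ring
    · intro c hc
      have hsq : Real.sqrt c * Real.sqrt c = c := Real.mul_self_sqrt hc.le
      have hs0 : Real.sqrt c ≠ 0 := (Real.sqrt_pos.2 hc).ne'
      have hsum : Real.sqrt c ^ h * ∑ v ∈ treeChildren par m u,
          explorationSum (fun _ => c) 0 k m E v =
          Real.sqrt c ^ (k + 2) * (1 / c * ∑ v ∈ treeChildren par m u, (Qc v).eval (1 / c)) := by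
        rw [Finset.mul_sum, Finset.mul_sum, Finset.mul_sum]
        refine Finset.sum_congr rfl fun v hv => mul_left_cancel₀ hs0 ?_
        rw [← mul_assoc, ← pow_succ', Qce v hv c hc]
        have : Real.sqrt c * (Real.sqrt c ^ (k + 2) * (1 / c * (Qc v).eval (1 / c))) =
          (Real.sqrt c * Real.sqrt c) * (1 / c) * (Real.sqrt c ^ (k + 1) * (Qc v).eval (1 / c)) := by
            ring
        rw [this, hsq, mul_one_div_cancel hc.ne', one_mul]
      have hnew := Qn_eval c hc
      rw [explorationSum, hT.sum_neighbors hu (fun E v => explorationSum (fun _ => c) 0 k m E v),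
        mul_add, mul_add, hsum, Qp_eval c hc]
      simp only [eval_add, eval_mul, eval_X, eval_finsetSum, mul_add]
      rw [add_assoc]
      congr 1
      calc _ = Real.sqrt c * (Real.sqrt c ^ (h + 1) *
            explorationSum (fun _ => c) 0 k (m + 1) (insert s(u, m) E) m) := by
            rw [pow_succ]
            linear_combination (-(Real.sqrt c ^ h) * explorationSum (fun _ => c) 0 k (m + 1)
              (insert s(u, m) E) m) * hsq
        _ = _ := by rw [hnew]; ring

/-! ### Expected walk counts in the binomial random graph -/

theorem Matrix.IsHermitian.sum_eigenvalues_pow {n : Type*} [Fintype n] [DecidableEq n]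
    {A : Matrix n n ℝ} (hA : A.IsHermitian) (k : ℕ) :
    ∑ i, hA.eigenvalues i ^ k = (A ^ k).trace := by
  conv_rhs => rw [hA.spectral_theorem, ← map_pow, Unitary.conjStarAlgAut_apply,
    Matrix.trace_mul_comm, ← mul_assoc, Matrix.diagonal_pow]
  simp [Matrix.trace]

namespace SimpleGraph

instance instMeasurableSingletonClass {V : Type*} [Finite V] :
    MeasurableSingletonClass (SimpleGraph V) where
  measurableSet_singleton G := by
    have h : edgeSet ⁻¹' {G.edgeSet} = {G} := by
      ext H
      simp
    rw [← h]
    exact measurable_edgeSet .of_discrete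

theorem binomialRandom_real_subset_edgeSet {V : Type*} [Finite V] (p : unitInterval)
    (H : Finset (Sym2 V)) (hH : ∀ e ∈ H, ¬ e.IsDiag) :
    (binomialRandom V p).real {G | (H : Set (Sym2 V)) ⊆ G.edgeSet} = (p : ℝ) ^ H.card := by
  have hpre : fromEdgeSet ⁻¹' {G : SimpleGraph V | (H : Set (Sym2 V)) ⊆ G.edgeSet} =
      {S : Set (Sym2 V) | (H : Set (Sym2 V)) ⊆ S} := by
    ext S
    simp only [Set.mem_preimage, Set.mem_ofPred_eq, edgeSet_fromEdgeSet, Set.subset_sdiff]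
    refine and_iff_left ?_
    rw [Set.disjoint_left]
    exact fun e he => hH e he
  have hpi : (fun q : Sym2 V → Prop => {i | q i}) ⁻¹' {S | (H : Set (Sym2 V)) ⊆ S} =
      Set.pi H fun _ => {True} := by
    ext q
    simp [Set.subset_def, Set.pi]
  rw [measureReal_def, binomialRandom_eq_map, Measure.map_apply measurable_fromEdgeSet .of_discrete,
    hpre, ProbabilityTheory.setBernoulli_apply', hpi, Measure.infinitePi_pi _ fun _ _ => .of_discrete]
  rw [Finset.prod_congr rfl (g := fun _ => ((unitInterval.toNNReal p : NNReal) : ENNReal))]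
  · simp
  · intro e he
    simp [hH e he]

-- Expand one matrix factor and sort the next vertex `x` into revealed and unseen ones. The
-- embedding `φ` names the revealed vertices, and the indicator records the edges used so far. By
-- exchangeability the value does not depend on `φ`, so the `n - m` unseen vertices contribute
-- equally.
open Classical in
theorem integral_indicator_adjMatrix_pow {n : ℕ} (p : unitInterval) (k : ℕ) :
    ∀ (m : ℕ) (E : Finset (Sym2 ℕ)) (u : ℕ) (φ : ℕ → Fin n), Set.InjOn φ (Set.Iio m) → u < m →
      (∀ e ∈ E, ∀ i ∈ e, i < m) → (∀ e ∈ E, ¬ e.IsDiag) →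
      ∫ G : SimpleGraph (Fin n), Set.indicator
          {G | ((E.image (Sym2.map φ) : Finset (Sym2 (Fin n))) : Set (Sym2 (Fin n))) ⊆ G.edgeSet}
          (fun G => (G.adjMatrix ℝ ^ k) (φ u) (φ 0)) G ∂(binomialRandom (Fin n) p) =
        (p : ℝ) ^ E.card * explorationSum (fun m => (n - m) * p) p k m E u := by
  induction k with
  | zero =>
    intro m E u φ hφ hu hE hdiag
    have hcard : (E.image (Sym2.map φ)).card = E.card := by
      refine Finset.card_image_of_injOn fun e he f hf hef => ?_
      induction e with | _ a b
      induction f with | _ c d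
      have ha := hE _ he a (by simp)
      have hb := hE _ he b (by simp)
      have hc := hE _ hf c (by simp)
      have hd := hE _ hf d (by simp)
      simp only [Sym2.map_mk, Sym2.eq_iff] at hef ⊢
      rwa [hφ.eq_iff ha hc, hφ.eq_iff hb hd, hφ.eq_iff ha hd, hφ.eq_iff hb hc] at hef
    have hnd : ∀ e ∈ E.image (Sym2.map φ), ¬ e.IsDiag := by
      simp only [Finset.mem_image, forall_exists_index, and_imp, forall_apply_eq_imp_iff₂]
      intro e he
      have h := hdiag e he
      induction e with | _ a b
      simp only [Sym2.map_mk, Sym2.mk_isDiag_iff] at h ⊢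
      rwa [hφ.eq_iff (hE _ he a (by simp)) (hE _ he b (by simp))]
    simp only [pow_zero, Matrix.one_apply, explorationSum]
    rw [integral_indicator_const _ .of_discrete, binomialRandom_real_subset_edgeSet p _ hnd, hcard,
      smul_eq_mul]
    simp only [hφ.eq_iff hu (Set.mem_Iio.2 (Nat.zero_lt_of_lt hu))]
  | succ k ih =>
    intro m E u φ hφ hu hE hdiag
    set F : Fin n → ℝ := fun x => ∫ G : SimpleGraph (Fin n), Set.indicator
      {G | ((E.image (Sym2.map φ) : Finset (Sym2 (Fin n))) : Set (Sym2 (Fin n))) ⊆ G.edgeSet}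
      (fun G => G.adjMatrix ℝ (φ u) x * (G.adjMatrix ℝ ^ k) x (φ 0)) G
        ∂(binomialRandom (Fin n) p) with hF
    have hsum : ∫ G : SimpleGraph (Fin n), Set.indicator
        {G | ((E.image (Sym2.map φ) : Finset (Sym2 (Fin n))) : Set (Sym2 (Fin n))) ⊆ G.edgeSet}
        (fun G => (G.adjMatrix ℝ ^ (k + 1)) (φ u) (φ 0)) G ∂(binomialRandom (Fin n) p) =
        ∑ x, F x := by
      rw [hF, ← integral_finsetSum _ fun _ _ => .of_finite]
      congr 1 with G
      simp only [Set.indicator_apply, pow_succ', Matrix.mul_apply]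
      split_ifs <;> simp
    have hFu : F (φ u) = 0 := by simp [hF]
    -- The adjacency entry is itself an indicator and is absorbed as one more required edge.
    have hFx : ∀ x, x ≠ φ u → F x = ∫ G : SimpleGraph (Fin n), Set.indicator
        {G | ((insert s(φ u, x) (E.image (Sym2.map φ)) : Finset (Sym2 (Fin n))) :
          Set (Sym2 (Fin n))) ⊆ G.edgeSet}
        (fun G => (G.adjMatrix ℝ ^ k) x (φ 0)) G ∂(binomialRandom (Fin n) p) := by
      intro x hx
      refine integral_congr_ae (.of_forall fun G => ?_)
      simp only [Set.indicator_apply, Set.mem_ofPred_eq, Finset.coe_insert, Set.insert_subset_iff,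
        mem_edgeSet, adjMatrix_apply]
      split_ifs <;> simp_all
    have hFold : ∀ v ∈ (Finset.range m).erase u, F (φ v) = p ^ E.card *
        ((if s(u, v) ∈ E then 1 else (p : ℝ)) *
          explorationSum (fun m => (n - m) * p) p k m (insert s(u, v) E) v) := by
      intro v hv
      obtain ⟨hvu, hvm⟩ := Finset.mem_erase.1 hv
      rw [Finset.mem_range] at hvm
      rw [hFx _ (by rwa [Ne, hφ.eq_iff hvm hu])]
      have := ih m (insert s(u, v) E) v φ hφ hvm (by
        simp only [Finset.mem_insert, forall_eq_or_imp]
        exact ⟨by simp [hu, hvm], hE⟩) (by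
        simp only [Finset.mem_insert, forall_eq_or_imp]
        exact ⟨by simpa using hvu.symm, hdiag⟩)
      rw [Finset.image_insert, Sym2.map_mk] at this
      rw [this]
      split_ifs with he
      · rw [Finset.insert_eq_of_mem he, one_mul]
      · rw [Finset.card_insert_of_notMem he, pow_succ]; ring
    have hFnew : ∀ x ∈ ((Finset.range m).image φ)ᶜ, F x = p ^ E.card *
        (p * explorationSum (fun m => (n - m) * p) p k (m + 1) (insert s(u, m) E) m) := by
      intro x hx
      simp only [Finset.mem_compl, Finset.mem_image, Finset.mem_range, not_exists, not_and] at hx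
      have hupd : ∀ i, i < m → Function.update φ m x i = φ i := fun i hi =>
        Function.update_of_ne hi.ne _ _
      have hnot : s(u, m) ∉ E := fun h => (hE _ h m (by simp)).ne rfl
      rw [hFx _ (Ne.symm (hx u hu))]
      have := ih (m + 1) (insert s(u, m) E) m (Function.update φ m x) (by
        intro i hi j hj hij
        simp only [Set.mem_Iio] at hi hj
        rcases (Nat.lt_succ_iff.1 hi).lt_or_eq with hi | rfl <;>
          rcases (Nat.lt_succ_iff.1 hj).lt_or_eq with hj | rfl
        · rw [hupd i hi, hupd j hj] at hij
          exact hφ hi hj hij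
        · rw [hupd i hi, Function.update_self] at hij
          exact absurd hij (hx i hi)
        · rw [hupd j hj, Function.update_self] at hij
          exact absurd hij.symm (hx j hj)
        · rfl) m.lt_succ_self (by
        simp only [Finset.mem_insert, forall_eq_or_imp]
        exact ⟨by simp; omega, fun e he i hi => (hE e he i hi).trans m.lt_succ_self⟩) (by
        simp only [Finset.mem_insert, forall_eq_or_imp]
        exact ⟨by simpa using hu.ne, hdiag⟩)
      have himg : E.image (Sym2.map (Function.update φ m x)) = E.image (Sym2.map φ) := by
        refine Finset.image_congr fun e he => ?_
        exact Sym2.map_congr fun i hi => hupd i (hE e he i hi)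
      rw [Finset.image_insert, Sym2.map_mk, himg, hupd u hu, Function.update_self,
        hupd 0 (by omega), Finset.card_insert_of_notMem hnot] at this
      rw [this, pow_succ]
      ring
    have hcard : ((Finset.range m).image φ).card = m := by
      rw [Finset.card_image_of_injOn (by simpa [Set.Iio] using hφ), Finset.card_range]
    have hmn : m ≤ n := by
      simpa [hcard] using Finset.card_le_univ ((Finset.range m).image φ)
    rw [hsum, ← Finset.sum_add_sum_compl ((Finset.range m).image φ),
      Finset.sum_image (by simpa [Set.Iio] using hφ),
      ← Finset.add_sum_erase _ _ (Finset.mem_range.2 hu), hFu, zero_add,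
      Finset.sum_congr rfl hFold, Finset.sum_congr rfl hFnew, Finset.sum_const, Finset.card_compl,
      hcard, Fintype.card_fin, ← Finset.mul_sum, nsmul_eq_mul, Nat.cast_sub hmn, explorationSum]
    ring

end SimpleGraph

/-! ### The mean spectral measure and its moments -/

/-- The average of the normalised spectral measures over the binomial random graph. -/
noncomputable def meanSpectralMeasure (c : ℝ) (n : ℕ) : Measure ℝ :=
  ∑ G : SimpleGraph (Fin n),
    SimpleGraph.binomialRandom (Fin n) (edgeProb c n) {G} • spectralMeasure c G

theorem integrable_spectralMeasure {F : Type*} [NormedAddCommGroup F] (c : ℝ) {n : ℕ}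
    (hn : n ≠ 0) (G : SimpleGraph (Fin n)) (f : ℝ → F) : Integrable f (spectralMeasure c G) := by
  refine Integrable.smul_measure ?_ (by simpa using hn)
  rw [integrable_finsetSum_measure]
  exact fun i _ => integrable_dirac (by simp)

theorem integral_spectralMeasure {F : Type*} [NormedAddCommGroup F] [NormedSpace ℝ F]
    [CompleteSpace F] (c : ℝ) {n : ℕ} (G : SimpleGraph (Fin n)) (f : ℝ → F) :
    ∫ x, f x ∂(spectralMeasure c G) =
      (n : ℝ)⁻¹ • ∑ i, f ((rescaledAdj_isHermitian c G).eigenvalues i) := by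
  rw [spectralMeasure, integral_smul_measure, integral_finsetSum_measure]
  · simp
  · exact fun i _ => integrable_dirac (by simp)

theorem integrable_meanSpectralMeasure {F : Type*} [NormedAddCommGroup F] (c : ℝ) {n : ℕ}
    (hn : n ≠ 0) (f : ℝ → F) : Integrable f (meanSpectralMeasure c n) := by
  rw [meanSpectralMeasure, integrable_finsetSum_measure]
  exact fun G _ => (integrable_spectralMeasure c hn G f).smul_measure (measure_ne_top _ _)

theorem integral_meanSpectralMeasure {F : Type*} [NormedAddCommGroup F] [NormedSpace ℝ F]
    [CompleteSpace F] (c : ℝ) {n : ℕ} (hn : n ≠ 0) (f : ℝ → F) :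
    ∫ x, f x ∂(meanSpectralMeasure c n) =
      ∫ G : SimpleGraph (Fin n), ∫ x, f x ∂(spectralMeasure c G)
        ∂(SimpleGraph.binomialRandom (Fin n) (edgeProb c n)) := by
  rw [meanSpectralMeasure, integral_finsetSum_measure, integral_fintype .of_finite]
  · simp only [integral_smul_measure, measureReal_def]
  · exact fun G _ => (integrable_spectralMeasure c hn G f).smul_measure (measure_ne_top _ _)

theorem isProbabilityMeasure_meanSpectralMeasure (c : ℝ) {n : ℕ} (hn : n ≠ 0) :
    IsProbabilityMeasure (meanSpectralMeasure c n) := by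
  have h : ∀ G : SimpleGraph (Fin n), spectralMeasure c G Set.univ = 1 := by
    intro G
    simp [spectralMeasure, ENNReal.inv_mul_cancel, hn]
  constructor
  simp only [meanSpectralMeasure, Measure.finsetSum_apply, Measure.smul_apply, h, smul_eq_mul,
    mul_one]
  rw [← measure_univ (μ := SimpleGraph.binomialRandom (Fin n) (edgeProb c n)),
    sum_measure_singleton]
  simp

theorem integral_pow_meanSpectralMeasure (c : ℝ) {n : ℕ} (hn : n ≠ 0) (k : ℕ) :
    ∫ x, x ^ k ∂(meanSpectralMeasure c n) = (Real.sqrt c)⁻¹ ^ k *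
      explorationSum (fun m => (n - m) * edgeProb c n) (edgeProb c n) k 1 ∅ 0 := by
  classical
  have hdiag : ∀ v : Fin n, ∫ G : SimpleGraph (Fin n), (G.adjMatrix ℝ ^ k) v v
      ∂(SimpleGraph.binomialRandom (Fin n) (edgeProb c n)) =
      explorationSum (fun m => (n - m) * edgeProb c n) (edgeProb c n) k 1 ∅ 0 := by
    intro v
    have := SimpleGraph.integral_indicator_adjMatrix_pow (edgeProb c n) k 1 ∅ 0 (fun _ => v)
      (fun i hi j hj _ => by simp at hi hj; omega) one_pos (by simp) (by simp)
    simp only [Finset.image_empty, Finset.coe_empty, Set.empty_subset, Set.ofPred_true,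
      Set.indicator_univ, Finset.card_empty, pow_zero, one_mul] at this
    convert this
  rw [integral_meanSpectralMeasure c hn]
  simp only [integral_spectralMeasure, Matrix.IsHermitian.sum_eigenvalues_pow, smul_eq_mul,
    rescaledAdj, smul_pow, Matrix.trace_smul]
  simp only [Matrix.trace, Matrix.diag_apply]
  rw [integral_const_mul, integral_const_mul, integral_finsetSum _ fun _ _ => .of_finite]
  have : (n : ℝ) ≠ 0 := by exact_mod_cast hn
  rw [Finset.sum_congr rfl (g := fun _ => explorationSum (fun m => (n - m) * edgeProb c n)
    (edgeProb c n) k 1 ∅ 0) fun v _ => by convert hdiag v]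
  rw [Finset.sum_const, Finset.card_univ, Fintype.card_fin, nsmul_eq_mul, mul_left_comm,
    inv_mul_cancel_left₀ this]

/-! ### Moments under weak convergence -/

theorem abs_sub_clamp_le {M : ℝ} (hM : 0 < M) (y : ℝ) : |y - max (-M) (min M y)| ≤ y ^ 2 / M := by
  rw [le_div_iff₀ hM]
  rcases le_total M y with h | h
  · rw [min_eq_left h, max_eq_right (by linarith), abs_of_nonneg (by linarith)]
    nlinarith
  · rw [min_eq_right h]
    rcases le_total (-M) y with h' | h'
    · rw [max_eq_right h', sub_self, abs_zero, zero_mul]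
      positivity
    · rw [max_eq_left h', abs_of_nonpos (by linarith)]
      nlinarith

/-- The continuous function `f` truncated to take values in `[-M, M]`. -/
noncomputable def clampedFunction (f : C(ℝ, ℝ)) (M : ℝ) : BoundedContinuousFunction ℝ ℝ :=
  BoundedContinuousFunction.ofNormedAddCommGroup (fun x => max (-M) (min M (f x)))
    (by fun_prop) |M| fun x => by
      rw [Real.norm_eq_abs, abs_le]
      have := neg_abs_le M
      have := le_abs_self M
      refine ⟨?_, max_le (by linarith [neg_le_abs M]) ((min_le_left _ _).trans this)⟩
      rcases le_total 0 M with h | h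
      · rw [abs_of_nonneg h]; exact le_max_left _ _
      · rw [abs_of_nonpos h, neg_neg]; exact le_max_of_le_left (by linarith)

theorem abs_integral_sub_clamped_le {ν : Measure ℝ} [IsFiniteMeasure ν] {k : ℕ} {M B : ℝ}
    (hM : 0 < M) (h1 : Integrable (fun x : ℝ => x ^ k) ν)
    (h2 : Integrable (fun x : ℝ => x ^ (2 * k)) ν) (hB : ∫ x, x ^ (2 * k) ∂ν ≤ B) :
    |∫ x, x ^ k ∂ν - ∫ x, clampedFunction ⟨fun x => x ^ k, by fun_prop⟩ M x ∂ν| ≤ B / M := by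
  rw [← Real.norm_eq_abs, ← integral_sub h1 (BoundedContinuousFunction.integrable ν _)]
  calc _ ≤ ∫ x, x ^ (2 * k) / M ∂ν := by
        refine norm_integral_le_of_norm_le (h2.div_const M) (.of_forall fun x => ?_)
        have := abs_sub_clamp_le hM (x ^ k)
        rwa [← pow_mul, mul_comm k] at this
    _ ≤ B / M := by
        rw [integral_div]
        gcongr

/-- The truncations `min M (x ^ (2 * k))` are bounded and continuous, so the bound `B` passes to the
limit for each `M`; then let `M` grow by monotone convergence. -/
theorem integrable_even_pow_of_tendsto {ν : ℕ → Measure ℝ} [∀ n, IsProbabilityMeasure (ν n)]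
    {μ : Measure ℝ} [IsProbabilityMeasure μ]
    (h : ∀ f : BoundedContinuousFunction ℝ ℝ,
      Tendsto (fun n => ∫ x, f x ∂(ν n)) atTop (𝓝 (∫ x, f x ∂μ)))
    {k : ℕ} (hint : ∀ n, Integrable (fun x : ℝ => x ^ (2 * k)) (ν n)) {B : ℝ}
    (hB : ∀ n, ∫ x, x ^ (2 * k) ∂(ν n) ≤ B) :
    Integrable (fun x : ℝ => x ^ (2 * k)) μ ∧ ∫ x, x ^ (2 * k) ∂μ ≤ B := by
  have hpos : ∀ x : ℝ, 0 ≤ x ^ (2 * k) := fun x => by rw [pow_mul]; positivity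
  have hB0 : 0 ≤ B := (integral_nonneg fun x => hpos x).trans (hB 0)
  set F : ℕ → BoundedContinuousFunction ℝ ℝ := fun M =>
    clampedFunction ⟨fun x => x ^ (2 * k), by fun_prop⟩ M with hF
  have hFe : ∀ M x, F M x = min (M : ℝ) (x ^ (2 * k)) := fun M x =>
    max_eq_right ((neg_nonpos.2 (Nat.cast_nonneg M)).trans (le_min (Nat.cast_nonneg M) (hpos x)))
  have hFB : ∀ M, ∫ x, F M x ∂μ ≤ B := fun M => by
    refine le_of_tendsto' (h (F M)) fun n => le_trans ?_ (hB n)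
    refine integral_mono (BoundedContinuousFunction.integrable _ _) (hint n) fun x => ?_
    simp only [hFe]
    exact min_le_right _ _
  have hl : ∫⁻ x, ENNReal.ofReal (x ^ (2 * k)) ∂μ ≤ ENNReal.ofReal B := by
    have ht : Tendsto (fun M : ℕ => ∫⁻ x, ENNReal.ofReal (F M x) ∂μ) atTop
        (𝓝 (∫⁻ x, ENNReal.ofReal (x ^ (2 * k)) ∂μ)) := by
      refine lintegral_tendsto_of_tendsto_of_monotone
        (fun M => (F M).continuous.measurable.ennreal_ofReal.aemeasurable) ?_ ?_
      · refine .of_forall fun x M N hMN => ENNReal.ofReal_le_ofReal ?_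
        simp only [hFe]
        exact min_le_min_right _ (by exact_mod_cast hMN)
      · refine .of_forall fun x => tendsto_const_nhds.congr' ?_
        filter_upwards [eventually_ge_atTop ⌈x ^ (2 * k)⌉₊] with M hM
        rw [hFe, min_eq_right (Nat.ceil_le.1 hM)]
    refine le_of_tendsto' ht fun M => ?_
    rw [← ofReal_integral_eq_lintegral_ofReal (BoundedContinuousFunction.integrable _ _)]
    · exact ENNReal.ofReal_le_ofReal (hFB M)
    · refine .of_forall fun x => ?_
      simp only [hFe]
      exact le_min (Nat.cast_nonneg M) (hpos x)
  have hi : Integrable (fun x : ℝ => x ^ (2 * k)) μ := by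
    refine ⟨by fun_prop, ?_⟩
    rw [hasFiniteIntegral_iff_ofReal (.of_forall hpos)]
    exact hl.trans_lt ENNReal.ofReal_lt_top
  refine ⟨hi, ?_⟩
  rw [← ofReal_integral_eq_lintegral_ofReal hi (.of_forall hpos)] at hl
  exact (ENNReal.ofReal_le_ofReal_iff hB0).1 hl

theorem integrable_abs_pow_of_even {μ : Measure ℝ} [IsFiniteMeasure μ] {k : ℕ}
    (h : Integrable (fun x : ℝ => x ^ (2 * k)) μ) : Integrable (fun x : ℝ => |x| ^ k) μ := by
  refine ((integrable_const (1 : ℝ)).add h).mono' (by fun_prop) (.of_forall fun x => ?_)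
  rw [Real.norm_of_nonneg (by positivity)]
  simp only [Pi.add_apply]
  rw [mul_comm, pow_mul, ← sq_abs, abs_pow]
  nlinarith [sq_nonneg (|x| ^ k - 1)]

/-- Under weak convergence, moments converge provided the even moments stay bounded. -/
theorem tendsto_integral_pow_of_tendsto {ν : ℕ → Measure ℝ} [∀ n, IsProbabilityMeasure (ν n)]
    {μ : Measure ℝ} [IsProbabilityMeasure μ]
    (h : ∀ f : BoundedContinuousFunction ℝ ℝ,
      Tendsto (fun n => ∫ x, f x ∂(ν n)) atTop (𝓝 (∫ x, f x ∂μ)))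
    {k : ℕ} (hint : ∀ n, Integrable (fun x : ℝ => x ^ (2 * k)) (ν n)) {B : ℝ}
    (hB : ∀ n, ∫ x, x ^ (2 * k) ∂(ν n) ≤ B) :
    Tendsto (fun n => ∫ x, x ^ k ∂(ν n)) atTop (𝓝 (∫ x, x ^ k ∂μ)) := by
  obtain ⟨hμ, hμB⟩ := integrable_even_pow_of_tendsto h hint hB
  have hB0 : 0 ≤ B :=
    (integral_nonneg fun x => by rw [Pi.zero_apply, pow_mul]; positivity).trans hμB
  have hk : ∀ {ρ : Measure ℝ} [IsFiniteMeasure ρ], Integrable (fun x : ℝ => x ^ (2 * k)) ρ →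
      Integrable (fun x : ℝ => x ^ k) ρ := fun hρ =>
    (integrable_abs_pow_of_even hρ).mono' (by fun_prop) (.of_forall fun x => by simp)
  rw [Metric.tendsto_atTop]
  intro ε hε
  obtain ⟨M, hM0, hM⟩ : ∃ M : ℝ, 0 < M ∧ B / M < ε / 3 := by
    refine ⟨3 * (B + 1) / ε, by positivity, ?_⟩
    rw [div_lt_iff₀ (by positivity)]
    field_simp
    linarith
  obtain ⟨N, hN⟩ := Metric.tendsto_atTop.1
    (h (clampedFunction ⟨fun x => x ^ k, by fun_prop⟩ M)) (ε / 3) (by positivity)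
  refine ⟨N, fun n hn => ?_⟩
  have h1 := abs_le.1 (abs_integral_sub_clamped_le hM0 (hk (hint n)) (hint n) (hB n))
  have h2 := abs_le.1 (abs_integral_sub_clamped_le hM0 (hk hμ) hμ hμB)
  have h3 := hN n hn
  rw [Real.dist_eq, abs_lt] at h3 ⊢
  constructor <;> linarith [h1.1, h1.2, h2.1, h2.2, h3.1, h3.2]

/-! ### Weak convergence from convergence of moments -/

open Complex in
/-- Probability measures whose moments converge, with moment bounds making the characteristic
functions entire, converge weakly. -/
theorem exists_tendsto_of_tendsto_moments {ν : ℕ → ProbabilityMeasure ℝ} {b m : ℕ → ℝ}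
    (hchar : ∀ n (t : ℝ), HasSum
      (fun k : ℕ => (t * I) ^ k / k.factorial * ((∫ x, x ^ k ∂(ν n : Measure ℝ) : ℝ) : ℂ))
      (charFun (ν n : Measure ℝ) t))
    (hm : ∀ k, Tendsto (fun n => ∫ x, x ^ k ∂(ν n : Measure ℝ)) atTop (𝓝 (m k)))
    (hb : ∀ n k, |∫ x, x ^ k ∂(ν n : Measure ℝ)| ≤ b k)
    (hsum : ∀ t : ℝ, Summable fun k : ℕ => t ^ k / k.factorial * b k) :
    ∃ μ : ProbabilityMeasure ℝ, Tendsto ν atTop (𝓝 μ) := by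
  have hb0 : ∀ k, 0 ≤ b k := fun k => (abs_nonneg _).trans (hb 0 k)
  have hmb : ∀ k, |m k| ≤ b k := fun k => le_of_tendsto' (hm k).abs fun n => hb n k
  have hbound : ∀ (t : ℝ) (k : ℕ) (y : ℝ), |y| ≤ b k →
      ‖(t * I) ^ k / k.factorial * (y : ℂ)‖ ≤ |t| ^ k / k.factorial * b k := by
    intro t k y hy
    simp only [norm_mul, norm_div, norm_pow, norm_I, mul_one, norm_real, Real.norm_eq_abs,
      norm_natCast]
    gcongr
  set φ : ℝ → ℂ := fun t => ∑' k : ℕ, (t * I) ^ k / k.factorial * (m k : ℂ) with hφ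
  have hlim : ∀ t, Tendsto (fun n => charFun (ν n : Measure ℝ) t) atTop (𝓝 (φ t)) := by
    intro t
    simp only [← (hchar _ t).tsum_eq]
    refine tendsto_tsum_of_dominated_convergence (hsum |t|) (fun k => ?_)
      (.of_forall fun n k => hbound t k _ (hb n k))
    exact (((continuous_ofReal.tendsto _).comp (hm k))).const_mul _
  have hcont : ContinuousAt φ 0 := by
    have : ContinuousOn φ (Metric.ball 0 1) := by
      refine continuousOn_tsum (fun k => by fun_prop) (hsum 1) fun k t ht => ?_
      refine (hbound t k _ (hmb k)).trans ?_
      have : |t| ≤ 1 := by simpa using (Metric.mem_ball.1 ht).le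
      have := hb0 k
      gcongr
    exact this.continuousAt (Metric.ball_mem_nhds _ one_pos)
  have htight : IsTightMeasureSet {((ρ : ProbabilityMeasure ℝ) : Measure ℝ) | ρ ∈ Set.range ν} := by
    have := isTightMeasureSet_of_tendsto_charFun (μ := fun n => (ν n : Measure ℝ)) hcont hlim
    convert this using 1
    ext ρ
    simp
  -- Tightness yields a limit along an ultrafilter. Its characteristic function must be `φ`, which
  -- upgrades the convergence to the whole sequence.
  obtain ⟨μ, -, hμ⟩ := (isCompact_closure_of_isTightMeasureSet htight).ultrafilter_le_nhds
    ((hyperfilter ℕ).map ν) (le_principal_iff.2 (mem_of_superset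
      (mem_map.2 (univ_mem' fun n => Set.mem_range_self n)) subset_closure))
  have hU : Tendsto ν (hyperfilter ℕ) (𝓝 μ) := hμ
  refine ⟨μ, ProbabilityMeasure.tendsto_of_tendsto_charFun fun t => ?_⟩
  have hUt : Tendsto (fun n => charFun (ν n : Measure ℝ) t) (hyperfilter ℕ)
      (𝓝 (charFun (μ : Measure ℝ) t)) := by
    rw [ProbabilityMeasure.tendsto_iff_forall_integral_rclike_tendsto ℂ] at hU
    simp_rw [charFun_eq_integral_innerProbChar]
    exact hU (BoundedContinuousFunction.innerProbChar t)
  rw [tendsto_nhds_unique hUt ((hlim t).mono_left Nat.hyperfilter_le_atTop)]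
  exact hlim t

/-! ### Integration against signed measures with a density -/

theorem integrable_variation_withDensityᵥ {μ : Measure ℝ} {ρ g : ℝ → ℝ} (hρm : Measurable ρ)
    (hρ : Integrable ρ μ) (hg : Integrable (fun x => g x * ρ x) μ) (hgm : Measurable g) :
    (μ.withDensityᵥ ρ).Integrable g := by
  rw [VectorMeasure.Integrable, Measure.variation_withDensityᵥ hρ,
    integrable_withDensity_iff hρm.enorm (.of_forall fun x => by simp)]
  refine hg.mono (by fun_prop) (.of_forall fun x => ?_)
  simp

theorem integral_withDensityᵥ_eq {μ : Measure ℝ} {ρ g : ℝ → ℝ} (hρm : Measurable ρ)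
    (hρ : Integrable ρ μ) (hg : Integrable (fun x => g x * ρ x) μ) (hgm : Measurable g) :
    ∫ᵛ x, g x ∂<•(μ.withDensityᵥ ρ) = ∫ x, g x * ρ x ∂μ := by
  -- Used for `r = ρ` and `r = -ρ`, the positive and negative parts of the density.
  have key : ∀ {r : ℝ → ℝ}, Measurable r → (∀ x, |r x| = |ρ x|) →
      Integrable g (μ.withDensity fun x => ENNReal.ofReal (r x)) ∧
      Integrable (fun x => max (r x) 0 * g x) μ ∧
      ∫ x, g x ∂(μ.withDensity fun x => ENNReal.ofReal (r x)) = ∫ x, max (r x) 0 * g x ∂μ := by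
    intro r hr hrρ
    have hi : Integrable (fun x => max (r x) 0 * g x) μ := by
      refine hg.mono (by fun_prop) (.of_forall fun x => ?_)
      rw [norm_mul, norm_mul, mul_comm, Real.norm_eq_abs (ρ x), ← hrρ]
      gcongr
      rw [Real.norm_of_nonneg (le_max_right _ _)]
      exact max_le (le_abs_self _) (abs_nonneg _)
    refine ⟨?_, hi, ?_⟩
    · rw [integrable_withDensity_iff hr.ennreal_ofReal (.of_forall fun x => by simp)]
      simpa only [ENNReal.toReal_ofReal', mul_comm] using hi
    · rw [integral_withDensity_eq_integral_toReal_smul hr.ennreal_ofReal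
        (.of_forall fun x => by simp)]
      simp only [ENNReal.toReal_ofReal', smul_eq_mul]
  obtain ⟨hp, hp', hpe⟩ := key hρm fun _ => rfl
  obtain ⟨hn, hn', hne⟩ := key hρm.neg fun x => abs_neg _
  simp only [Pi.neg_apply] at hn hn' hne
  have := isFiniteMeasure_withDensity_ofReal hρ.2
  have := isFiniteMeasure_withDensity_ofReal hρ.neg.2
  rw [withDensityᵥ_eq_withDensity_pos_part_sub_withDensity_neg_part hρ,
    VectorMeasure.integral_sub_vectorMeasure, VectorMeasure.integral_toSignedMeasure,
    VectorMeasure.integral_toSignedMeasure, hpe, hne, ← integral_sub hp' hn']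
  · refine integral_congr_ae (.of_forall fun x => ?_)
    simp only
    rcases le_total 0 (ρ x) with h | h
    · rw [max_eq_left h, max_eq_right (by linarith)]; ring
    · rw [max_eq_right h, max_eq_left (by linarith)]; ring
  · simpa [VectorMeasure.Integrable] using hp
  · simpa [VectorMeasure.Integrable] using hn

/-! ### The substitution `x = 2 cos θ` and the semicircle moments -/

theorem image_two_mul_cos : (fun θ => 2 * Real.cos θ) '' Set.Ioo 0 Real.pi = Set.Ioo (-2) 2 := by
  ext x
  constructor
  · rintro ⟨θ, ⟨h0, h1⟩, rfl⟩
    have hs := Real.sin_pos_of_pos_of_lt_pi h0 h1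
    have := Real.sin_sq_add_cos_sq θ
    constructor <;> simp only <;> nlinarith
  · rintro ⟨h0, h1⟩
    refine ⟨Real.arccos (x / 2), ⟨Real.arccos_pos.2 (by linarith), ?_⟩, ?_⟩
    · refine lt_of_le_of_ne (Real.arccos_le_pi _) fun h => ?_
      rw [Real.arccos_eq_pi] at h
      linarith
    · simp only
      rw [Real.cos_arccos (by linarith) (by linarith)]
      ring

theorem hasDerivWithinAt_two_mul_cos (s : Set ℝ) (θ : ℝ) :
    HasDerivWithinAt (fun θ => 2 * Real.cos θ) (2 * -Real.sin θ) s θ :=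
  ((Real.hasDerivAt_cos θ).const_mul 2).hasDerivWithinAt

theorem injOn_two_mul_cos : Set.InjOn (fun θ => 2 * Real.cos θ) (Set.Ioo 0 Real.pi) :=
  fun _ ha _ hb h => Real.injOn_cos (Set.Ioo_subset_Icc_self ha) (Set.Ioo_subset_Icc_self hb)
    (by simpa using h)

/-- The substitution `x = 2 cos θ` for functions supported on `(-2, 2)`. -/
theorem integral_indicator_Ioo_eq {h g : ℝ → ℝ} (hg : Continuous g)
    (hgh : ∀ θ ∈ Set.Ioo 0 Real.pi, 2 * Real.sin θ * h (2 * Real.cos θ) = g θ) :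
    Integrable ((Set.Ioo (-2 : ℝ) 2).indicator h) ∧
      ∫ x, (Set.Ioo (-2 : ℝ) 2).indicator h x = ∫ θ in (0 : ℝ)..Real.pi, g θ := by
  have hcongr : Set.EqOn g (fun θ => |2 * -Real.sin θ| • h (2 * Real.cos θ))
      (Set.Ioo 0 Real.pi) := fun θ hθ => by
    have := Real.sin_pos_of_pos_of_lt_pi hθ.1 hθ.2
    simp only [mul_neg, abs_neg, smul_eq_mul]
    rw [abs_of_pos (by positivity), hgh θ hθ]
  rw [integrable_indicator_iff measurableSet_Ioo, integral_indicator measurableSet_Ioo,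
    ← image_two_mul_cos, integrableOn_image_iff_integrableOn_abs_deriv_smul measurableSet_Ioo
      (fun θ _ => hasDerivWithinAt_two_mul_cos _ θ) injOn_two_mul_cos,
    integral_image_eq_integral_abs_deriv_smul measurableSet_Ioo
      (fun θ _ => hasDerivWithinAt_two_mul_cos _ θ) injOn_two_mul_cos]
  constructor
  · exact ((hg.integrableOn_Icc).mono_set Set.Ioo_subset_Icc_self).congr_fun hcongr
      measurableSet_Ioo
  · rw [intervalIntegral.integral_of_le Real.pi_pos.le, integral_Ioc_eq_integral_Ioo]
    exact setIntegral_congr_fun measurableSet_Ioo hcongr.symm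

/-- The Fourier coefficients of `(2 cos θ) ^ k`. -/
noncomputable def cosMoment (k : ℕ) (j : ℤ) : ℝ :=
  1 / Real.pi * ∫ θ in (0 : ℝ)..Real.pi, (2 * Real.cos θ) ^ k * Real.cos (j * θ)

theorem cosMoment_zero_zero : cosMoment 0 0 = 1 := by
  simp [cosMoment, Real.pi_ne_zero]

theorem cosMoment_zero_of_pos (j : ℤ) (hj : 0 < j) : cosMoment 0 j = 0 := by
  have hj' : (j : ℝ) ≠ 0 := by exact_mod_cast hj.ne'
  simp [cosMoment, intervalIntegral.integral_comp_mul_left _ hj', Real.sin_int_mul_pi]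

theorem cosMoment_neg (k : ℕ) (j : ℤ) : cosMoment k (-j) = cosMoment k j := by
  simp [cosMoment]

/-- From `2 cos θ cos jθ = cos (j + 1)θ + cos (j - 1)θ`; this is the simple random walk recursion
required of `P`. -/
theorem cosMoment_succ (k : ℕ) (j : ℤ) :
    cosMoment (k + 1) j = cosMoment k (j + 1) + cosMoment k (j - 1) := by
  rw [cosMoment, cosMoment, cosMoment, ← mul_add, ← intervalIntegral.integral_add
    (Continuous.intervalIntegrable (by fun_prop) _ _)
    (Continuous.intervalIntegrable (by fun_prop) _ _)]
  congr 2 with θ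
  push_cast
  rw [add_mul, sub_mul, one_mul, Real.cos_add, Real.cos_sub]
  ring

/-- Density times Jacobian is `(2 / π) sin² θ = (1 / π) (1 - cos 2θ)`. -/
theorem integral_pow_mul_semicircleDensity (k : ℕ) :
    Integrable (fun x => x ^ k * semicircleDensity x) ∧
      ∫ x, x ^ k * semicircleDensity x = cosMoment k 0 - cosMoment k 2 := by
  have h := integral_indicator_Ioo_eq
    (h := fun x => x ^ k * (1 / (2 * Real.pi) * Real.sqrt (4 - x ^ 2)))
    (g := fun θ => 1 / Real.pi * ((2 * Real.cos θ) ^ k * Real.cos ((0 : ℤ) * θ) -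
      (2 * Real.cos θ) ^ k * Real.cos ((2 : ℤ) * θ))) (by fun_prop) (by
    intro θ hθ
    have hs := Real.sin_pos_of_pos_of_lt_pi hθ.1 hθ.2
    have hsq : Real.sqrt (4 - (2 * Real.cos θ) ^ 2) = 2 * Real.sin θ := by
      rw [Real.sqrt_eq_iff_mul_self_eq (by nlinarith [Real.cos_sq_le_one θ]) (by positivity)]
      nlinarith [Real.sin_sq_add_cos_sq θ]
    rw [hsq]
    push_cast
    rw [zero_mul, Real.cos_zero, Real.cos_two_mul, Real.cos_sq']
    field_simp
    ring)
  have he : ∀ x, x ^ k * semicircleDensity x = (Set.Ioo (-2 : ℝ) 2).indicator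
      (fun x => x ^ k * (1 / (2 * Real.pi) * Real.sqrt (4 - x ^ 2))) x := fun x => by
    simp only [semicircleDensity, Set.indicator_apply, mul_ite, mul_zero]
  simp only [he]
  refine ⟨h.1, h.2.trans ?_⟩
  rw [intervalIntegral.integral_const_mul, intervalIntegral.integral_sub
    (Continuous.intervalIntegrable (by fun_prop) _ _)
    (Continuous.intervalIntegrable (by fun_prop) _ _), mul_sub, cosMoment, cosMoment]

/-- At `x = 2 cos θ` one has `x ^ 4 - 4 * x ^ 2 + 2 = 2 cos 4θ`, and the Jacobian cancels the square
root. -/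
theorem integral_pow_mul_correctionDensity (k : ℕ) :
    Integrable (fun x => x ^ k * correctionDensity x) ∧
      ∫ x, x ^ k * correctionDensity x = cosMoment k 4 := by
  have h := integral_indicator_Ioo_eq
    (h := fun x => x ^ k * (1 / (2 * Real.pi) * ((x ^ 4 - 4 * x ^ 2 + 2) / Real.sqrt (4 - x ^ 2))))
    (g := fun θ => 1 / Real.pi * ((2 * Real.cos θ) ^ k * Real.cos ((4 : ℤ) * θ))) (by fun_prop) (by
    intro θ hθ
    have hs := Real.sin_pos_of_pos_of_lt_pi hθ.1 hθ.2
    have hsq : Real.sqrt (4 - (2 * Real.cos θ) ^ 2) = 2 * Real.sin θ := by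
      rw [Real.sqrt_eq_iff_mul_self_eq (by nlinarith [Real.cos_sq_le_one θ]) (by positivity)]
      nlinarith [Real.sin_sq_add_cos_sq θ]
    rw [hsq]
    push_cast
    rw [show (4 : ℝ) * θ = 2 * (2 * θ) by ring, Real.cos_two_mul (2 * θ), Real.cos_two_mul]
    field_simp
    ring)
  have he : ∀ x, x ^ k * correctionDensity x = (Set.Ioo (-2 : ℝ) 2).indicator
      (fun x => x ^ k * (1 / (2 * Real.pi) *
        ((x ^ 4 - 4 * x ^ 2 + 2) / Real.sqrt (4 - x ^ 2)))) x := fun x => by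
    simp only [correctionDensity, Set.indicator_apply, mul_ite, mul_zero]
  simp only [he]
  refine ⟨h.1, h.2.trans ?_⟩
  rw [intervalIntegral.integral_const_mul, cosMoment]

theorem measurable_semicircleDensity : Measurable semicircleDensity :=
  Measurable.indicator (by fun_prop) measurableSet_Ioo

theorem measurable_correctionDensity : Measurable correctionDensity :=
  Measurable.indicator (by fun_prop) measurableSet_Ioo

theorem integrable_semicircleDensity : Integrable semicircleDensity := by
  simpa using (integral_pow_mul_semicircleDensity 0).1

theorem integrable_correctionDensity : Integrable correctionDensity := by
  simpa using (integral_pow_mul_correctionDensity 0).1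

theorem semicircleLaw_univ : semicircleLaw Set.univ = 1 := by
  rw [semicircleLaw, withDensityᵥ_apply integrable_semicircleDensity .univ, setIntegral_univ]
  have := (integral_pow_mul_semicircleDensity 0).2
  simpa [cosMoment_zero_zero, cosMoment_zero_of_pos] using this

theorem semicircleCorrection_univ : semicircleCorrection Set.univ = 0 := by
  rw [semicircleCorrection, withDensityᵥ_apply integrable_correctionDensity .univ,
    setIntegral_univ]
  have := (integral_pow_mul_correctionDensity 0).2
  simpa [cosMoment_zero_of_pos] using this

theorem hasMoment_semicircleLaw_add (r : ℝ) (k : ℕ) :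
    HasMoment k (semicircleLaw + r • semicircleCorrection) := by
  have habs : ∀ {f : ℝ → ℝ}, Measurable f → Integrable (fun x => x ^ k * f x) →
      Integrable (fun x => |x| ^ k * f x) := fun hm h =>
    h.mono (by fun_prop) (.of_forall fun x => by simp)
  rw [HasMoment, SignedMeasure.totalVariation_eq_variation]
  exact VectorMeasure.Integrable.add_vectorMeasure
    (integrable_variation_withDensityᵥ measurable_semicircleDensity integrable_semicircleDensity
      (habs measurable_semicircleDensity (integral_pow_mul_semicircleDensity k).1) (by fun_prop))
    (VectorMeasure.Integrable.smul_vectorMeasure (integrable_variation_withDensityᵥ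
      measurable_correctionDensity integrable_correctionDensity
      (habs measurable_correctionDensity (integral_pow_mul_correctionDensity k).1)
      (by fun_prop)) r)

theorem signedMoment_semicircleLaw_add (r : ℝ) (k : ℕ) :
    signedMoment k (semicircleLaw + r • semicircleCorrection) =
      cosMoment k 0 - cosMoment k 2 + r * cosMoment k 4 := by
  obtain ⟨hs, hse⟩ := integral_pow_mul_semicircleDensity k
  obtain ⟨hc, hce⟩ := integral_pow_mul_correctionDensity k
  rw [signedMoment, VectorMeasure.integral_add_vectorMeasure,
    VectorMeasure.integral_smul_vectorMeasure, semicircleLaw, semicircleCorrection,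
    integral_withDensityᵥ_eq measurable_semicircleDensity integrable_semicircleDensity hs
      (by fun_prop),
    integral_withDensityᵥ_eq measurable_correctionDensity integrable_correctionDensity hc
      (by fun_prop), hse, hce, smul_eq_mul]
  · exact integrable_variation_withDensityᵥ measurable_semicircleDensity
      integrable_semicircleDensity hs (by fun_prop)
  · exact VectorMeasure.Integrable.smul_vectorMeasure (integrable_variation_withDensityᵥ
      measurable_correctionDensity integrable_correctionDensity hc (by fun_prop)) r

/-! ### The limit `n → ∞`: existence, uniqueness and moments of the limit law -/

theorem edgeProb_le {c : ℝ} (hc : 0 ≤ c) (n : ℕ) : (n : ℝ) * edgeProb c n ≤ c := by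
  rw [edgeProb, Set.coe_projIcc]
  rcases Nat.eq_zero_or_pos n with rfl | hn
  · simpa using hc
  · have hn' : (0 : ℝ) < n := by exact_mod_cast hn
    calc (n : ℝ) * max 0 (min 1 (c / n)) ≤ n * (c / n) := by
          gcongr
          exact max_le (by positivity) (min_le_right _ _)
      _ = c := by field_simp

theorem edgeProb_eq {c : ℝ} (hc : 0 ≤ c) {n : ℕ} (hn : c < n) : (edgeProb c n : ℝ) = c / n := by
  have hn' : (0 : ℝ) < n := hc.trans_lt hn
  rw [edgeProb, Set.coe_projIcc, min_eq_right ((div_le_one hn').2 hn.le),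
    max_eq_right (by positivity)]

theorem tendsto_edgeProb {c : ℝ} (hc : 0 ≤ c) :
    Tendsto (fun n => (edgeProb c n : ℝ)) atTop (𝓝 0) := by
  refine (tendsto_const_div_atTop_nhds_zero_nat c).congr' ?_
  filter_upwards [tendsto_natCast_atTop_atTop.eventually_gt_atTop c] with n hn
  exact (edgeProb_eq hc hn).symm

theorem tendsto_sub_mul_edgeProb {c : ℝ} (hc : 0 ≤ c) (m : ℕ) :
    Tendsto (fun n : ℕ => ((n : ℝ) - m) * edgeProb c n) atTop (𝓝 c) := by
  have h : Tendsto (fun n : ℕ => c - m * (edgeProb c n : ℝ)) atTop (𝓝 c) := by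
    simpa using tendsto_const_nhds.sub ((tendsto_edgeProb hc).const_mul (m : ℝ))
  refine h.congr' ?_
  filter_upwards [tendsto_natCast_atTop_atTop.eventually_gt_atTop c] with n hn
  have : (n : ℝ) ≠ 0 := (hc.trans_lt hn).ne'
  rw [edgeProb_eq hc hn]
  field_simp

/-- The limit of the moments of the mean spectral measures. -/
noncomputable def limitMoment (c : ℝ) (k : ℕ) : ℝ :=
  (Real.sqrt c)⁻¹ ^ k * explorationSum (fun _ => c) 0 k 1 ∅ 0

/-- A bound for the moments of the mean spectral measures, uniform in the number of vertices. -/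
noncomputable def momentBound (c : ℝ) (k : ℕ) : ℝ :=
  (Real.sqrt c)⁻¹ ^ k * poissonMoment c k 1

theorem tendsto_moment_meanSpectralMeasure {c : ℝ} (hc : 0 ≤ c) (k : ℕ) :
    Tendsto (fun n : ℕ => ∫ x, x ^ k ∂(meanSpectralMeasure c (n + 1))) atTop
      (𝓝 (limitMoment c k)) := by
  have h := (tendsto_add_atTop_iff_nat 1).2 ((tendsto_explorationSum
    (fun m => tendsto_sub_mul_edgeProb hc m) (tendsto_edgeProb hc) k 1 ∅ 0).const_mul
    ((Real.sqrt c)⁻¹ ^ k))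
  refine h.congr fun n => (integral_pow_meanSpectralMeasure c n.succ_ne_zero k).symm

theorem abs_moment_meanSpectralMeasure_le {c : ℝ} (hc : 0 ≤ c) (n k : ℕ) :
    |∫ x, x ^ k ∂(meanSpectralMeasure c (n + 1))| ≤ momentBound c k := by
  obtain ⟨h0, h1⟩ := explorationSum_nonneg_and_le (edgeProb c (n + 1)).2.1 (edgeProb c (n + 1)).2.2
    hc (edgeProb_le hc (n + 1)) k 1 ∅ 0 (by omega) one_pos
  rw [integral_pow_meanSpectralMeasure c n.succ_ne_zero, abs_of_nonneg (by positivity),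
    momentBound]
  gcongr

theorem summable_momentBound {c : ℝ} (hc : 0 ≤ c) (t : ℝ) :
    Summable fun k : ℕ => t ^ k / k.factorial * momentBound c k := by
  set s := |t| * (Real.sqrt c)⁻¹ with hs
  have hs0 : 0 ≤ s := by positivity
  -- The Poisson bound holds for every `r > 0`; taking `r > s` makes the series geometric with ratio
  -- `s / r < 1`.
  set r := s + 1 with hr
  have hr0 : 0 < r := by positivity
  have hgeom : Summable fun k : ℕ =>
      (s * r⁻¹) ^ k * (Real.exp (r * (1 : ℕ)) * Real.exp (c * Real.exp r)) := by
    refine (summable_geometric_of_lt_one (by positivity) ?_).mul_right _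
    rw [← div_eq_mul_inv, div_lt_one hr0]
    linarith
  refine hgeom.of_norm_bounded fun k => ?_
  have hp := poissonMoment_le hc hr0 k 1
  have hp0 := poissonMoment_nonneg hc k 1
  rw [momentBound, norm_mul, norm_div, norm_pow, Real.norm_eq_abs t, Real.norm_of_nonneg
    (by positivity : (0 : ℝ) ≤ (Real.sqrt c)⁻¹ ^ k * poissonMoment c k 1),
    Real.norm_of_nonneg (by positivity : (0 : ℝ) ≤ k.factorial)]
  calc _ = s ^ k * ((k.factorial : ℝ)⁻¹ * poissonMoment c k 1) := by rw [hs, mul_pow]; ring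
    _ ≤ s ^ k * ((k.factorial : ℝ)⁻¹ * (k.factorial * r⁻¹ ^ k * Real.exp (r * (1 : ℕ)) *
        Real.exp (c * Real.exp r))) := by gcongr
    _ = _ := by
        have : (k.factorial : ℝ) ≠ 0 := by positivity
        rw [mul_pow s r⁻¹]
        field_simp

/-- The mean measure is a finite combination of Dirac masses, so pointwise summability suffices. -/
theorem hasSum_integral_meanSpectralMeasure (c : ℝ) {n : ℕ} (hn : n ≠ 0) {f : ℕ → ℝ → ℂ}
    {g : ℝ → ℂ} (h : ∀ x, HasSum (fun k => f k x) (g x)) :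
    HasSum (fun k => ∫ x, f k x ∂(meanSpectralMeasure c n)) (∫ x, g x ∂(meanSpectralMeasure c n)) := by
  simp only [integral_meanSpectralMeasure c hn, integral_spectralMeasure,
    integral_fintype Integrable.of_finite]
  exact hasSum_sum fun G _ => ((hasSum_sum fun i _ => h _).const_smul _).const_smul _

open Complex in
theorem hasSum_charFun_meanSpectralMeasure (c : ℝ) {n : ℕ} (hn : n ≠ 0) (t : ℝ) :
    HasSum (fun k : ℕ => (t * I) ^ k / k.factorial *
      ((∫ x, x ^ k ∂(meanSpectralMeasure c n) : ℝ) : ℂ)) (charFun (meanSpectralMeasure c n) t) := by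
  have h := hasSum_integral_meanSpectralMeasure c hn
    (f := fun k x => (t * I) ^ k / k.factorial * ((x ^ k : ℝ) : ℂ))
    (g := fun x => Complex.exp (t * x * I)) fun x => by
      have := NormedSpace.expSeries_div_hasSum_exp (𝔸 := ℂ) (t * x * I)
      rw [← Complex.exp_eq_exp_ℂ] at this
      refine this.congr_fun fun k => ?_
      push_cast
      ring
  rw [charFun_apply_real]
  refine h.congr_fun fun k => ?_
  rw [integral_const_mul, integral_complex_ofReal]

/-- The shift to `n + 1` discards the empty graph, whose spectral measure is zero and not a
probability. -/
theorem isLimitingSpectralMeasure_iff {c : ℝ} {μ : Measure ℝ} :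
    IsLimitingSpectralMeasure c μ ↔ ∀ f : BoundedContinuousFunction ℝ ℝ,
      Tendsto (fun n : ℕ => ∫ x, f x ∂(meanSpectralMeasure c (n + 1))) atTop (𝓝 (∫ x, f x ∂μ)) := by
  refine forall_congr' fun f => ?_
  rw [← tendsto_add_atTop_iff_nat 1]
  simp only [integral_meanSpectralMeasure c (Nat.succ_ne_zero _)]

theorem exists_isLimitingSpectralMeasure {c : ℝ} (hc : 0 ≤ c) :
    ∃ μ : ProbabilityMeasure ℝ, IsLimitingSpectralMeasure c (μ : Measure ℝ) := by
  obtain ⟨μ, hμ⟩ := exists_tendsto_of_tendsto_moments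
    (ν := fun n => ⟨meanSpectralMeasure c (n + 1),
      isProbabilityMeasure_meanSpectralMeasure c n.succ_ne_zero⟩)
    (fun n t => hasSum_charFun_meanSpectralMeasure c n.succ_ne_zero t)
    (fun k => tendsto_moment_meanSpectralMeasure hc k)
    (fun n k => abs_moment_meanSpectralMeasure_le hc n k)
    (summable_momentBound hc)
  exact ⟨μ, isLimitingSpectralMeasure_iff.2
    (ProbabilityMeasure.tendsto_iff_forall_integral_tendsto.1 hμ)⟩

theorem IsLimitingSpectralMeasure.unique {c : ℝ} {μ μ' : ProbabilityMeasure ℝ}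
    (h : IsLimitingSpectralMeasure c (μ : Measure ℝ))
    (h' : IsLimitingSpectralMeasure c (μ' : Measure ℝ)) : μ = μ' :=
  Subtype.ext <| ext_of_forall_integral_eq_of_IsFiniteMeasure
    (μ := (μ : Measure ℝ)) (ν := (μ' : Measure ℝ)) fun f =>
    tendsto_nhds_unique (h f) (h' f)

theorem IsLimitingSpectralMeasure.moments {c : ℝ} (hc : 0 ≤ c) {μ : Measure ℝ}
    [IsProbabilityMeasure μ] (h : IsLimitingSpectralMeasure c μ) (k : ℕ) :
    Integrable (fun x : ℝ => |x| ^ k) μ ∧ ∫ x, x ^ k ∂μ = limitMoment c k := by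
  rw [isLimitingSpectralMeasure_iff] at h
  have := fun n : ℕ => isProbabilityMeasure_meanSpectralMeasure c n.succ_ne_zero
  have hint := fun n : ℕ => integrable_meanSpectralMeasure c n.succ_ne_zero
    (fun x : ℝ => x ^ (2 * k))
  have hB := fun n : ℕ => (le_abs_self _).trans (abs_moment_meanSpectralMeasure_le hc n (2 * k))
  exact ⟨integrable_abs_pow_of_even (integrable_even_pow_of_tendsto h hint hB).1,
    tendsto_nhds_unique (tendsto_integral_pow_of_tendsto h hint hB)
      (tendsto_moment_meanSpectralMeasure hc k)⟩

/-! ### First-order expansion as `c → ∞` -/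

open Polynomial in
theorem exists_polynomial_limitMoment (k : ℕ) : ∃ Q : ℝ[X],
    Q.coeff 0 = cosMoment k 0 - cosMoment k 2 ∧ Q.coeff 1 = cosMoment k 4 ∧
      ∀ c : ℝ, 0 < c → limitMoment c k = Q.eval (1 / c) := by
  have hT : IsRecursiveTree 1 ∅ fun _ => 0 :=
    ⟨fun v hv => hv, fun u v => by simp; omega⟩
  -- The walk starts at the root of the one-vertex tree, so `h = 1` and `s = 0`.
  obtain ⟨Q, Q0, Q1, Qe⟩ := hT.exists_polynomial cosMoment cosMoment_zero_zero
    cosMoment_zero_of_pos cosMoment_succ cosMoment_neg k 1 ∅ (fun _ => 0) 0 one_pos 1 0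
    (ancestorSum_zero (fun _ => 0) fun _ => 1).symm (by rw [ancestorSum_zero]; rfl)
  refine ⟨Q, by simpa using Q0, by simpa using Q1, fun c hc => ?_⟩
  have hs : Real.sqrt c ≠ 0 := (Real.sqrt_pos.2 hc).ne'
  have h := Qe c hc
  rw [pow_one, pow_succ', mul_assoc] at h
  rw [limitMoment, mul_left_cancel₀ hs h, inv_pow, inv_mul_cancel_left₀ (pow_ne_zero _ hs)]

-- Removing two coefficients leaves `x ^ 2` times a polynomial, which stays bounded near `x = 1 / c
-- = 0`.
open Polynomial in
theorem Polynomial.isLittleO_eval_one_div_sub (Q : ℝ[X]) :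
    (fun c : ℝ => Q.eval (1 / c) - (Q.coeff 0 + 1 / c * Q.coeff 1)) =o[atTop]
      fun c : ℝ => 1 / c := by
  have heval : ∀ x : ℝ, Q.eval x - (Q.coeff 0 + x * Q.coeff 1) = x * (x * Q.divX.divX.eval x) := by
    intro x
    have h1 := congrArg (eval x) Q.divX_mul_X_add
    have h2 := congrArg (eval x) Q.divX.divX_mul_X_add
    simp only [eval_add, eval_mul, eval_X, eval_C, coeff_divX] at h1 h2
    linear_combination -h1 - x * h2
  have hinv : Tendsto (fun c : ℝ => 1 / c) atTop (𝓝 0) := by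
    simpa only [one_div] using tendsto_inv_atTop_zero
  have hlim : Tendsto (fun c : ℝ => 1 / c * Q.divX.divX.eval (1 / c)) atTop (𝓝 0) := by
    simpa using hinv.mul ((Q.divX.divX.continuous.tendsto 0).comp hinv)
  simp only [heval]
  simpa using (isBigO_refl (fun c : ℝ => 1 / c) atTop).mul_isLittleO
    ((isLittleO_one_iff ℝ).2 hlim)

theorem theorem1 :
    (∀ c : ℝ, 0 < c →
      ∃! μ : ProbabilityMeasure ℝ, IsLimitingSpectralMeasure c (μ : Measure ℝ)) ∧
    (Integrable semicircleDensity ∧ semicircleLaw Set.univ = 1) ∧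
    (Integrable correctionDensity ∧ semicircleCorrection Set.univ = 0) ∧
    ∀ μ : ℝ → ProbabilityMeasure ℝ,
      (∀ c : ℝ, 0 < c → IsLimitingSpectralMeasure c (μ c : Measure ℝ)) →
      ∀ k : ℕ,
        (∀ c : ℝ, 0 < c → Integrable (fun x : ℝ => |x| ^ k) (μ c : Measure ℝ)) ∧
        (∀ c : ℝ, 0 < c → HasMoment k (semicircleLaw + (1 / c) • semicircleCorrection)) ∧
        (fun c : ℝ => (∫ x, x ^ k ∂(μ c : Measure ℝ)) -
            signedMoment k (semicircleLaw + (1 / c) • semicircleCorrection))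
          =o[atTop] (fun c : ℝ => 1 / c) := by
  refine ⟨fun c hc => ?_, ⟨integrable_semicircleDensity, semicircleLaw_univ⟩,
    ⟨integrable_correctionDensity, semicircleCorrection_univ⟩, fun μ hμ k =>
      ⟨fun c hc => ((hμ c hc).moments hc.le k).1, fun c _ => hasMoment_semicircleLaw_add _ k, ?_⟩⟩
  · obtain ⟨μ, hμ⟩ := exists_isLimitingSpectralMeasure hc.le
    exact ⟨μ, hμ, fun μ' hμ' => hμ'.unique hμ⟩
  · obtain ⟨Q, Q0, Q1, Qe⟩ := exists_polynomial_limitMoment k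
    refine Q.isLittleO_eval_one_div_sub.congr' ?_ .rfl
    filter_upwards [eventually_gt_atTop 0] with c hc
    rw [((hμ c hc).moments hc.le k).2, Qe c hc, signedMoment_semicircleLaw_add, Q0, Q1]
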